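/- All matroids are on finite ground sets; $M(A)$ means that $M$ has ground set $A$, and $r_M$ is its rank function. For $X\subseteq A$, $M|X$ is the restriction of $M$ to $X$ and $M.X=M/(A-X)$ is the contraction of $M$ to $X$; $I(X)$ is the free matroid on $X$ (every element an isthmus) and $I^*(X)$ its dual (every element a loop). A pair $(M(A),N(B))$ is matched if $M.(A\cap B)=N|(A\cap B)$. For matroids $N',M'$ on a common ground set such that every flat of $N'$ is a flat of $M'$, the $i$th Higgs lift of $N'$ towards $M'$ is the matroid on that set with rank function $X\mapsto\min\{r_{M'}(X),\,r_{N'}(X)+i\}$. The free splice $M\Join N$ of a matched pair $(M(A),N(B))$ is the $i$th Higgs lift of $N\oplus I^*(A-B)$ towards $M\oplus I(B-A)$, where $i=r_M(A-B)$; it is a matroid on $A\cup B$. A pair $(X,Y)$ of subsets of the ground set of $M$ is a modular pair in $M$ if $r_M(X)+r_M(Y)=r_M(X\cup Y)+r_M(X\cap Y)$. Theorem. Suppose that $M(A)$, $N(B)$ and $P(C)$ are matroids such that the pairs $(M,N)$, $(M\Join N,P)$, $(N,P)$ and $(M,N\Join P)$ are matched. Then $(M\Join N)\Join P=M\Join(N\Join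 P)$ if and only if either $(A\cap C)-B=\emptyset$ or at least one of the following statements holds: (a) every element of $(A\cap C)-B$ is an isthmus of $M$, and every element of $B-A$ is an isthmus of $N$; (b) every element of $(A\cap C)-B$ is a loop of $P$, and every element of $B-C$ is a loop of $N$; (c) (i) $B\subseteq A\cup C$; (ii) every element of $B-A$ is an isthmus of $N$ and every element of $B-C$ is a loop of $N$; and (iii) $((A\cap C)-B,\;A\cap B\cap C)$ is a modular pair in $P$. -/

import Mathlib

open Set
open scoped Matroid

namespace FreeSplice

universe u

/-- The matroid on a finite set `E` with rank function `r`, where `r` is bounded by cardinality,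
order-preserving and submodular: a subset `I` of `E` is independent when `r I = |I|`. -/
noncomputable def matroidOfRank {α : Type u} (E : Set α) (hE : E.Finite) (r : Set α → ℕ)
    (r_le : ∀ X, X ⊆ E → r X ≤ X.ncard)
    (r_mono : ∀ X Y, X ⊆ Y → Y ⊆ E → r X ≤ r Y)
    (r_submod : ∀ X Y, X ⊆ E → Y ⊆ E → r (X ∪ Y) + r (X ∩ Y) ≤ r X + r Y) : Matroid α :=
  (IndepMatroid.ofFinite hE (fun I ↦ I ⊆ E ∧ r I = I.ncard)
    (by
      refine ⟨empty_subset E, ?_⟩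
      have h := r_le ∅ (empty_subset E)
      simp only [ncard_empty] at h ⊢
      omega)
    (by
      rintro I J ⟨hJE, hJ⟩ hIJ
      have hIE := hIJ.trans hJE
      refine ⟨hIE, ?_⟩
      have hJfin := hE.subset hJE
      have hsub := r_submod I (J \ I) hIE (sdiff_subset.trans hJE)
      rw [union_sdiff_cancel hIJ] at hsub
      have h1 := r_le (J \ I) (sdiff_subset.trans hJE)
      have h2 := r_le I hIE
      have h3 := ncard_sdiff_add_ncard_of_subset hIJ hJfin
      omega)
    (by
      rintro I J ⟨hIE, hI⟩ ⟨hJE, hJ⟩ hlt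
      by_contra! hcon
      have hIfin := hE.subset hIE
      have key : ∀ S : Set α, S.Finite → S ⊆ J → r (I ∪ S) = r I := by
        intro S hS
        induction S, hS using Set.Finite.induction_on with
        | empty => simp
        | @insert e S heS hS ih =>
          intro hSJ
          rw [insert_subset_iff] at hSJ
          have ih' := ih hSJ.2
          by_cases heI : e ∈ I
          · rw [union_insert, Set.insert_eq_of_mem (mem_union_left S heI), ih']
          have heE := hJE hSJ.1
          have hIeE : insert e I ⊆ E := insert_subset heE hIE
          have hISE : I ∪ S ⊆ E := union_subset hIE (hSJ.2.trans hJE)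
          have hne := hcon e hSJ.1 heI hIeE
          have hle := r_le _ hIeE
          rw [ncard_insert_of_notMem heI hIfin] at hne hle
          have hm := r_mono I (insert e I) (subset_insert _ _) hIeE
          have hs := r_submod (I ∪ S) (insert e I) hISE hIeE
          have hu : (I ∪ S) ∪ insert e I = I ∪ insert e S := by
            ext x; simp only [mem_union, mem_insert_iff]; tauto
          have hi : (I ∪ S) ∩ insert e I = I := by
            ext x
            simp only [mem_union, mem_insert_iff, mem_inter_iff]
            constructor
            · rintro ⟨h | h, rfl | h'⟩ <;> first | assumption | exact absurd h heS
            · tauto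
          rw [hu, hi] at hs
          have hm2 := r_mono I (I ∪ insert e S) subset_union_left
            (union_subset hIE (insert_subset heE (hSJ.2.trans hJE)))
          omega
      have h1 := key J (hE.subset hJE) Subset.rfl
      have h2 := r_mono J (I ∪ J) subset_union_right (union_subset hIE hJE)
      omega)
    (fun I hI ↦ hI.1)).matroid

theorem matroidOfRank_indep_iff {α : Type u} {E : Set α} {hE : E.Finite} {r : Set α → ℕ}
    {r_le r_mono r_submod} {I : Set α} :
    (matroidOfRank E hE r r_le r_mono r_submod).Indep I ↔ I ⊆ E ∧ r I = I.ncard := by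
  simp [matroidOfRank, IndepMatroid.ofFinite]

/-- The rank function of `matroidOfRank` is the prescribed one. -/
theorem matroidOfRank_eRk {α : Type u} {E : Set α} {hE : E.Finite} {r : Set α → ℕ}
    {r_le r_mono r_submod} {X : Set α} (hX : X ⊆ E) :
    (matroidOfRank E hE r r_le r_mono r_submod).eRk X = r X := by
  set L := matroidOfRank E hE r r_le r_mono r_submod with hL
  obtain ⟨I, hI⟩ := L.exists_isBasis X hX
  have hIi := hI.indep
  rw [hL, matroidOfRank_indep_iff] at hIi
  have hIfin := hE.subset hIi.1
  rw [hI.eRk_eq_encard, ← hIfin.cast_ncard_eq, ← hIi.2]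
  have key : ∀ S : Set α, S.Finite → S ⊆ X → r (I ∪ S) = r I := by
    intro S hS
    induction S, hS using Set.Finite.induction_on with
    | empty => simp
    | @insert e S heS hS ih =>
      intro hSX
      rw [insert_subset_iff] at hSX
      have ih' := ih hSX.2
      by_cases heI : e ∈ I
      · rw [union_insert, Set.insert_eq_of_mem (mem_union_left S heI), ih']
      have heE := hX hSX.1
      have hIeE : insert e I ⊆ E := insert_subset heE hIi.1
      have hISE : I ∪ S ⊆ E := union_subset hIi.1 (hSX.2.trans hX)
      have hne : r (insert e I) ≠ (insert e I).ncard := by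
        intro h
        have hi : L.Indep (insert e I) := by
          rw [hL, matroidOfRank_indep_iff]; exact ⟨hIeE, h⟩
        exact heI (by
          rw [hI.eq_of_subset_indep hi (subset_insert _ _) (insert_subset hSX.1 hI.subset)]
          exact mem_insert _ _)
      have hle := r_le _ hIeE
      rw [ncard_insert_of_notMem heI hIfin] at hne hle
      have hm := r_mono I (insert e I) (subset_insert _ _) hIeE
      have hs := r_submod (I ∪ S) (insert e I) hISE hIeE
      have hu : (I ∪ S) ∪ insert e I = I ∪ insert e S := by
        ext x; simp only [mem_union, mem_insert_iff]; tauto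
      have hi : (I ∪ S) ∩ insert e I = I := by
        ext x
        simp only [mem_union, mem_insert_iff, mem_inter_iff]
        constructor
        · rintro ⟨h | h, rfl | h'⟩ <;> first | assumption | exact absurd h heS
        · tauto
      rw [hu, hi] at hs
      have hm2 := r_mono I (I ∪ insert e S) subset_union_left
        (union_subset hIi.1 (insert_subset heE (hSX.2.trans hX)))
      omega
  have h := key X (hE.subset hX) Subset.rfl
  rw [union_eq_self_of_subset_left hI.subset] at h
  rw [h]

/-- The strong order `N ⊴ M`: `N` and `M` have the same ground set and every flat of `N`
is a flat of `M`. -/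
def IsQuotient {α : Type u} (N M : Matroid α) : Prop :=
  N.E = M.E ∧ ∀ F, N.IsFlat F → M.IsFlat F

/-- For `N ⊴ M`, the difference of the rank functions of `M` and `N` is order-preserving. -/
theorem IsQuotient.eRk_add_le {α : Type u} {N M : Matroid α} (h : IsQuotient N M)
    {X Y : Set α} (hXY : X ⊆ Y) (hY : Y ⊆ M.E) :
    N.eRk Y + M.eRk X ≤ M.eRk Y + N.eRk X := by
  have hcl : ∀ Z, Z ⊆ M.E → M.closure Z ⊆ N.closure Z := by
    intro Z hZ
    rw [← h.1] at hZ
    have hfl := (h.2 _ (N.isFlat_closure Z)).closure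
    exact (M.closure_subset_closure (N.subset_closure Z hZ)).trans hfl.subset
  obtain ⟨I, hI⟩ := M.exists_isBasis X (hXY.trans hY)
  obtain ⟨J, hJ, hIJ⟩ := hI.indep.subset_isBasis_of_subset (hI.subset.trans hXY) hY
  have hXJ : X ∪ J \ I ⊆ M.E := union_subset (hXY.trans hY)
    (sdiff_subset.trans (hJ.subset.trans hY))
  have hJsub : J ⊆ X ∪ J \ I := by
    intro x hx
    by_cases hxI : x ∈ I
    · exact Or.inl (hI.subset hxI)
    · exact Or.inr ⟨hx, hxI⟩
  have hYcl : Y ⊆ N.closure (X ∪ J \ I) :=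
    (hJ.subset_closure.trans (M.closure_subset_closure hJsub)).trans (hcl _ hXJ)
  have h1 : N.eRk Y ≤ N.eRk X + (J \ I).encard := by
    refine (N.eRk_mono hYcl).trans ?_
    rw [N.eRk_closure_eq]
    exact N.eRk_union_le_eRk_add_encard X (J \ I)
  have h2 : M.eRk Y = (J \ I).encard + M.eRk X := by
    rw [hI.eRk_eq_encard, hJ.eRk_eq_encard, encard_sdiff_add_encard_of_subset hIJ]
  rw [h2]
  calc N.eRk Y + M.eRk X ≤ (N.eRk X + (J \ I).encard) + M.eRk X := by gcongr
    _ = _ := by ring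

/-- The (finite) rank of a set in a finite matroid, as a natural number. -/
noncomputable def rk {α : Type u} (M : Matroid α) (X : Set α) : ℕ := (M.eRk X).toNat

theorem cast_rk {α : Type u} (M : Matroid α) [M.Finite] (X : Set α) :
    (rk M X : ℕ∞) = M.eRk X :=
  ENat.natCast_toNat (ne_top_of_le_ne_top (M.eRank_ne_top_iff.2 inferInstance)
    (M.eRk_le_eRank X))

theorem IsQuotient.finite {α : Type u} {N M : Matroid α} [M.Finite] (h : IsQuotient N M) :
    N.Finite :=
  ⟨by rw [h.1]; exact M.ground_finite⟩

/-- The `i`th Higgs lift of `N` towards `M`, for `N ⊴ M`: the matroid with rank function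
`X ↦ min (r_M X) (r_N X + i)`. -/
noncomputable def higgsLift {α : Type u} (i : ℕ) (M N : Matroid α) [M.Finite]
    (h : IsQuotient N M) : Matroid α :=
  matroidOfRank M.E M.ground_finite (fun X ↦ min (rk M X) (rk N X + i))
    (by
      intro X hX
      refine (min_le_left _ _).trans ?_
      have hle := M.eRk_le_encard X
      rw [← cast_rk, ← (M.ground_finite.subset hX).cast_ncard_eq] at hle
      exact_mod_cast hle)
    (by
      intro X Y hXY hY
      have := h.finite
      have h1 := M.eRk_mono hXY
      have h2 := N.eRk_mono hXY
      simp only [← cast_rk, Nat.cast_le] at h1 h2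
      change min _ _ ≤ min _ _
      omega)
    (by
      intro X Y hX hY
      have := h.finite
      have h1 := M.eRk_inter_add_eRk_union_le X Y
      have h2 := N.eRk_inter_add_eRk_union_le X Y
      have h3 := h.eRk_add_le (inter_subset_left (s := X) (t := Y)) hX
      have h4 := h.eRk_add_le (inter_subset_right (s := X) (t := Y)) hY
      simp only [← cast_rk] at h1 h2 h3 h4
      norm_cast at h1 h2 h3 h4
      change min _ _ + min _ _ ≤ min _ _ + min _ _
      omega)

@[simp] theorem higgsLift_ground {α : Type u} (i : ℕ) (M N : Matroid α) [M.Finite]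
    (h : IsQuotient N M) : (higgsLift i M N h).E = M.E := rfl

theorem higgsLift_eRk {α : Type u} (i : ℕ) (M N : Matroid α) [M.Finite]
    (h : IsQuotient N M) {X : Set α} (hX : X ⊆ M.E) :
    (higgsLift i M N h).eRk X = min (M.eRk X) (N.eRk X + i) := by
  have := h.finite
  rw [higgsLift, matroidOfRank_eRk hX, ← cast_rk, ← cast_rk]
  rfl

/-- `M ⊕ I(B - A)`: the elements of `B` outside the ground set `A` of `M` are adjoined to `M`
as isthmuses. -/
def addIsthmuses {α : Type u} (M : Matroid α) (B : Set α) : Matroid α :=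
  M.disjointSum (Matroid.freeOn (B \ M.E))
    (by rw [Matroid.freeOn_ground]; exact disjoint_sdiff_right)

/-- `N ⊕ I*(A - B)`: the elements of `A` outside the ground set `B` of `N` are adjoined to `N`
as loops. -/
def addLoops {α : Type u} (N : Matroid α) (A : Set α) : Matroid α :=
  N.disjointSum (Matroid.loopyOn (A \ N.E))
    (by rw [Matroid.loopyOn_ground]; exact disjoint_sdiff_right)

/-- The pair `(M, N)`, with ground sets `A` and `B`, is matched: contracting `M` to `A ∩ B`
(that is, contracting `A - B`) gives the restriction of `N` to `A ∩ B`. -/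
def Matched {α : Type u} (M N : Matroid α) : Prop :=
  M ／ (M.E \ N.E) = N ↾ (M.E ∩ N.E)

theorem addIsthmuses_ground {α : Type u} (M : Matroid α) (B : Set α) :
    (addIsthmuses M B).E = M.E ∪ B := by
  simp [addIsthmuses]

instance addIsthmuses_finite {α : Type u} (M N : Matroid α) [M.Finite] [N.Finite] :
    (addIsthmuses M N.E).Finite :=
  ⟨by rw [addIsthmuses_ground]; exact M.ground_finite.union N.ground_finite⟩

theorem Matched.isQuotient {α : Type u} {M N : Matroid α} (h : Matched M N) :
    IsQuotient (addLoops N M.E) (addIsthmuses M N.E) := by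
  refine ⟨by simp [addLoops, addIsthmuses, union_comm], fun F hF ↦ ?_⟩
  have hFE : F ⊆ M.E ∪ N.E := by
    have := hF.subset_ground
    simpa [addLoops, union_comm] using this
  obtain ⟨K, hK⟩ := N.exists_isBasis (F ∩ N.E)
  have hKN : K ⊆ N.E := hK.indep.subset_ground
  have hKdisj : K ∩ (M.E \ N.E) = ∅ := by
    ext x; simp only [mem_inter_iff, mem_sdiff, mem_empty_iff_false, iff_false]
    exact fun hx ↦ hx.2.2 (hKN hx.1)
  have hb1 : (addLoops N M.E).IsBasis K F := by
    rw [addLoops, Matroid.disjointSum_isBasis_iff]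
    refine ⟨by rwa [inter_eq_self_of_subset_left hKN], ?_,
      hK.subset.trans inter_subset_left, by simpa [union_comm] using hFE⟩
    simp [hKdisj]
  have hb2 : (addLoops N M.E).IsBasis K (N.closure (F ∩ N.E) ∪ (M.E \ N.E)) := by
    have hcN := N.closure_subset_ground (F ∩ N.E)
    rw [addLoops, Matroid.disjointSum_isBasis_iff]
    refine ⟨?_, by simp [hKdisj], ?_, ?_⟩
    · rw [inter_eq_self_of_subset_left hKN, union_inter_distrib_right, sdiff_inter_self,
        union_empty, inter_eq_self_of_subset_left hcN]
      exact hK.isBasis_closure_right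
    · exact (hK.subset.trans (N.subset_closure _ inter_subset_right)).trans subset_union_left
    · exact union_subset_union hcN Subset.rfl
  have hclF := hF.subset_of_isBasis_of_isBasis hb1 hb2
  have hloops : M.E \ N.E ⊆ F := subset_union_right.trans hclF
  have hclN : N.closure (F ∩ N.E) ⊆ F := subset_union_left.trans hclF
  have hclM : M.closure (F ∩ M.E) ⊆ F := by
    intro x hx
    by_cases hxN : x ∈ N.E
    swap
    · exact hloops ⟨M.closure_subset_ground _ hx, hxN⟩
    have hxM := M.closure_subset_ground _ hx
    have heq : F ∩ M.E = (F ∩ (M.E ∩ N.E)) ∪ (M.E \ N.E) := by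
      ext y
      simp only [mem_inter_iff, mem_union, mem_sdiff]
      constructor
      · tauto
      · rintro (h | h)
        · tauto
        · exact ⟨hloops h, h.1⟩
    have hx' : x ∈ (M ／ (M.E \ N.E)).closure (F ∩ (M.E ∩ N.E)) := by
      rw [Matroid.contract_closure_eq, ← heq]
      exact ⟨hx, fun h ↦ h.2 hxN⟩
    rw [show M ／ (M.E \ N.E) = N ↾ (M.E ∩ N.E) from h,
      Matroid.restrict_closure_eq _ inter_subset_right inter_subset_right] at hx'
    exact hclN (N.closure_subset_closure
      (inter_subset_inter_right F inter_subset_right) hx'.1)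
  refine ⟨fun I X hI hX ↦ ?_, by rwa [addIsthmuses_ground]⟩
  rw [addIsthmuses, Matroid.disjointSum_isBasis_iff] at hI hX
  intro x hx
  rcases hX.2.2.2 hx with hxM | hxB
  · apply hclM
    rw [← hI.1.closure_eq_closure, hX.1.closure_eq_closure]
    exact M.subset_closure _ inter_subset_right ⟨hx, hxM⟩
  · have h1 := (Matroid.freeOn_isBasis_iff.1 hX.2.1).1
    have : x ∈ I ∩ (Matroid.freeOn (N.E \ M.E)).E := by
      have h2 : x ∈ X ∩ (Matroid.freeOn (N.E \ M.E)).E := ⟨hx, hxB⟩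
      rwa [← h1] at h2
    exact hI.2.2.1 this.1

/-- The free splice of a matched pair of matroids `M` and `N` on finite sets `A` and `B`:
the `i`th Higgs lift of `N ⊕ I*(A - B)` towards `M ⊕ I(B - A)`, where `i = r_M (A - B)`. -/
noncomputable def freeSplice {α : Type u} (M N : Matroid α) [M.Finite] [N.Finite]
    (h : Matched M N) : Matroid α :=
  higgsLift (rk M (M.E \ N.E)) (addIsthmuses M N.E) (addLoops N M.E) h.isQuotient

theorem freeSplice_ground {α : Type u} (M N : Matroid α) [M.Finite] [N.Finite]
    (h : Matched M N) : (freeSplice M N h).E = M.E ∪ N.E := by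
  rw [freeSplice, higgsLift_ground, addIsthmuses_ground]

instance freeSplice_finite {α : Type u} (M N : Matroid α) [M.Finite] [N.Finite]
    (h : Matched M N) : (freeSplice M N h).Finite :=
  ⟨by rw [freeSplice_ground]; exact M.ground_finite.union N.ground_finite⟩

/-- `(X, Y)` is a modular pair of subsets of the ground set of `M`. -/
def IsModularPair {α : Type u} (M : Matroid α) (X Y : Set α) : Prop :=
  X ⊆ M.E ∧ Y ⊆ M.E ∧ M.eRk X + M.eRk Y = M.eRk (X ∪ Y) + M.eRk (X ∩ Y)

end FreeSplice

/-! Let `A`, `B`, `C` be the ground sets of `M`, `N`, `P`, and put D = (A ∩ C) \ B, m = r_M(A \ B),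
m' = r_M(A \ (B ∪ C)), β = r_N(B \ C), b = |B \ (A ∪ C)|, c = |X ∩ (C \ (A ∪ B))|, and G = the rank
of (A ∪ B) \ C in M ⋈ N. Expanding the Higgs lifts, the rank of X in either iterated splice is a
minimum of three terms. The first term, r_M(X) + |X ∩ (B \ A)| + c, is common. The second is r_N(X)
+ m + c on the left and r_N(X) + |X ∩ D| + m' + c on the right; the third is r_P(X) + G on the left
and r_P(X) + β + m' on the right.

The matchings are linear relations between ranks (`Matched.rk_union`). They give m - m' = min(|D|,
r_P(D) + β) (`rk_add_rk_sdiff`) and G = min(r_N((A ∩ B) \ C) + b + m', β + m)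
(`rk_freeSplice_sdiff`).

Sufficiency: each degeneracy condition makes the third terms agree, and either makes the second
terms agree or makes both redundant beside the first or the third.

Necessity: comparing the ranks of the whole ground sets forces G = β + m'. If m = m', then D is
empty or (b) holds. If m > m', then B \ A consists of isthmuses of `N`, and (a) or (c) holds
according to whether |D| attains the minimum for m - m'. -/

namespace FreeSplice

/-! ### Rank calculus, and the rank function of a free splice -/

section Rank

variable {α : Type*} {M : Matroid α} {X Y S C : Set α}

/-- Rank ignores points off the ground set, so subsets of the union of several ground sets can be
measured in each matroid without trimming. -/
theorem rk_congr (h : X ∩ M.E = Y ∩ M.E) : rk M X = rk M Y := by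
  rw [rk, rk, ← M.eRk_inter_ground X, h, M.eRk_inter_ground]

theorem rk_mono [M.Finite] (h : X ⊆ Y) : rk M X ≤ rk M Y := by
  have := M.eRk_mono h
  simpa only [← cast_rk, Nat.cast_le] using this

theorem rk_submod (M : Matroid α) [M.Finite] (X Y : Set α) :
    rk M (X ∪ Y) + rk M (X ∩ Y) ≤ rk M X + rk M Y := by
  have := M.eRk_inter_add_eRk_union_le X Y
  simp only [← cast_rk] at this
  norm_cast at this
  omega

theorem rk_union_le_add_rk (M : Matroid α) [M.Finite] (X Y : Set α) :
    rk M (X ∪ Y) ≤ rk M X + rk M Y :=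
  (Nat.le_add_right _ _).trans (rk_submod M X Y)

theorem rk_le_ncard [M.Finite] (hX : X.Finite) : rk M X ≤ X.ncard := by
  have := M.eRk_le_encard X
  rw [← cast_rk, ← hX.cast_ncard_eq] at this
  exact_mod_cast this

theorem rk_union_le_add_ncard [M.Finite] (X : Set α) (hY : Y.Finite) :
    rk M (X ∪ Y) ≤ rk M X + Y.ncard :=
  (rk_union_le_add_rk M X Y).trans (Nat.add_le_add_left (rk_le_ncard hY) _)

@[simp] theorem rk_empty (M : Matroid α) : rk M ∅ = 0 := by simp [rk]

theorem ext_rk {M N : Matroid α} [M.Finite] [N.Finite] (hE : M.E = N.E)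
    (h : ∀ X, X ⊆ M.E → rk M X = rk N X) : M = N := by
  refine Matroid.ext_indep hE fun I hI ↦ ?_
  rw [Matroid.indep_iff_eRk_eq_encard, Matroid.indep_iff_eRk_eq_encard, ← cast_rk, ← cast_rk,
    h I hI]

theorem subset_loops_iff_rk [M.Finite] (hS : S ⊆ M.E) : S ⊆ M.loops ↔ rk M S = 0 := by
  rw [← Matroid.eRk_eq_zero_iff hS, ← cast_rk, Nat.cast_eq_zero]

/-- Coloops are the loops of the dual, so this is the vanishing of the dual rank of `S`. -/
theorem subset_coloops_iff_rk [M.Finite] (hS : S ⊆ M.E) :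
    S ⊆ M.coloops ↔ rk M M.E = rk M (M.E \ S) + S.ncard := by
  have h := M.eRk_dual_add_eRank S hS
  rw [← M.dual_loops, ← Matroid.eRk_eq_zero_iff (M := M✶) hS, ← cast_rk, Nat.cast_eq_zero]
  rw [← Matroid.eRk_ground, ← cast_rk, ← cast_rk, ← cast_rk,
    ← (M.ground_finite.subset hS).cast_ncard_eq] at h
  norm_cast at h
  omega

/-- A set of coloops contributes its cardinality to the rank of every set. -/
theorem rk_eq_of_rk_ground [M.Finite] (hS : S ⊆ M.E)
    (h : rk M M.E = rk M (M.E \ S) + S.ncard) (X : Set α) :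
    rk M X = rk M (X \ S) + (X ∩ S).ncard := by
  have hfin := M.ground_finite.subset hS
  -- Lower bound on the rank of `X`: submodularity against the complement of `S`, after which the
  -- ground set is recovered by adding `S \ X`.
  have h1 := rk_submod M X (M.E \ S)
  have h2 : rk M (X ∩ (M.E \ S)) = rk M (X \ S) := rk_congr (by ext; simp; tauto)
  have h3 := rk_union_le_add_ncard (M := M) (X ∪ (M.E \ S)) (hfin.sdiff (t := X))
  have h4 : rk M (X ∪ (M.E \ S) ∪ S \ X) = rk M M.E :=
    rk_congr (by ext x; have := @hS x; simp; tauto)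
  have h5 := rk_union_le_add_ncard (M := M) (X \ S) (hfin.inter_of_right X)
  rw [sdiff_union_inter] at h5
  have h6 := ncard_inter_add_ncard_sdiff_eq_ncard S X hfin
  rw [inter_comm] at h6
  omega

/-- A basis of `C` extended to one of `X ∪ C` leaves a set independent in the contraction;
conversely a basis of `X` in the contraction, joined to the basis of `C`, is independent in `M`. The
additive form avoids truncated subtraction. -/
theorem rk_contract [M.Finite] (C X : Set α) :
    rk (M ／ C) X + rk M C = rk M (X ∪ C) := by
  have hfin : (M ／ C).Finite := ⟨M.ground_finite.subset sdiff_subset⟩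
  obtain ⟨I, hI⟩ := M.exists_isBasis' C
  obtain ⟨J, hJ⟩ := (M ／ C).exists_isBasis' X
  obtain ⟨K, hK, hIK⟩ := hI.indep.subset_isBasis'_of_subset (hI.subset.trans subset_union_right)
    (X := X ∪ C)
  have hJi := hI.contract_indep_iff.1 hJ.indep
  have hKC : K ∩ C = I :=
    (hI.eq_of_subset_indep (hK.indep.inter_right C) (subset_inter hIK hI.subset)
      inter_subset_right).symm
  have hdisj : Disjoint C (K \ I) := by
    rw [disjoint_left]; rintro x hx ⟨hxK, hxI⟩
    exact hxI (hKC ▸ ⟨hxK, hx⟩)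
  have hKi : (M ／ C).Indep (K \ I) := by
    rw [hI.contract_indep_iff, sdiff_union_of_subset hIK]
    exact ⟨hK.indep, hdisj⟩
  have hKX : K \ I ⊆ X := fun x hx ↦ (hK.subset hx.1).resolve_right
    (disjoint_right.1 hdisj hx)
  have h1 := hKi.encard_le_eRk_of_subset hKX
  have h2 := hJi.1.encard_le_eRk_of_subset (union_subset_union hJ.subset hI.subset)
  rw [encard_union_eq (hJi.2.symm.mono_right hI.subset), hI.encard_eq_eRk, hJ.encard_eq_eRk,
    ← cast_rk, ← cast_rk, ← cast_rk] at h2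
  have h3 := encard_sdiff_add_encard_of_subset hIK
  rw [hI.encard_eq_eRk, hK.encard_eq_eRk] at h3
  rw [← cast_rk] at h1
  have h5 : M.eRk (X ∪ C) ≤ (rk (M ／ C) X : ℕ∞) + M.eRk C := by
    rw [← h3]; gcongr
  rw [← cast_rk, ← cast_rk] at h5
  norm_cast at h2 h5
  omega

/-- The matching condition as a linear relation between ranks, the form in which `omega` can use it.
-/
theorem Matched.rk_union {N : Matroid α} [M.Finite] [N.Finite] (h : Matched M N) {Z : Set α}
    (hZ : Z ⊆ M.E ∩ N.E) : rk M (Z ∪ M.E \ N.E) = rk N Z + rk M (M.E \ N.E) := by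
  have h1 : rk (N ↾ (M.E ∩ N.E)) Z = rk N Z := by rw [rk, Matroid.restrict_eRk_eq _ hZ, rk]
  rw [← rk_contract, h, h1]

theorem disjointSum_eRk {N : Matroid α} (h : Disjoint M.E N.E) (X : Set α) :
    (M.disjointSum N h).eRk X = M.eRk X + N.eRk X := by
  obtain ⟨I, hI⟩ := M.exists_isBasis (X ∩ M.E)
  obtain ⟨J, hJ⟩ := N.exists_isBasis (X ∩ N.E)
  have hIJ : Disjoint I J := h.mono hI.indep.subset_ground hJ.indep.subset_ground
  have h1 : (I ∪ J) ∩ M.E = I := by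
    rw [union_inter_distrib_right, inter_eq_self_of_subset_left hI.indep.subset_ground,
      (h.symm.mono_left hJ.indep.subset_ground).inter_eq, union_empty]
  have h2 : (I ∪ J) ∩ N.E = J := by
    rw [union_inter_distrib_right, inter_eq_self_of_subset_left hJ.indep.subset_ground,
      (h.mono_left hI.indep.subset_ground).inter_eq, empty_union]
  have hb : (M.disjointSum N h).IsBasis (I ∪ J) (X ∩ (M.E ∪ N.E)) := by
    rw [Matroid.disjointSum_isBasis_iff, h1, h2, inter_assoc, inter_assoc,
      union_inter_cancel_left, union_inter_cancel_right, inter_union_distrib_left]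
    exact ⟨hI, hJ, union_subset_union hI.subset hJ.subset,
      union_subset_union inter_subset_right inter_subset_right⟩
  rw [← Matroid.eRk_inter_ground, Matroid.disjointSum_ground_eq, ← hb.encard_eq_eRk,
    encard_union_eq hIJ, hI.encard_eq_eRk, hJ.encard_eq_eRk, Matroid.eRk_inter_ground,
    Matroid.eRk_inter_ground]

theorem rk_freeSplice {N : Matroid α} [M.Finite] [N.Finite] (h : Matched M N) (X : Set α) :
    rk (freeSplice M N h) X =
      min (rk M X + (X ∩ (N.E \ M.E)).ncard) (rk N X + rk M (M.E \ N.E)) := by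
  have hX : X ∩ (M.E ∪ N.E) ⊆ (addIsthmuses M N.E).E := by
    rw [addIsthmuses_ground]; exact inter_subset_right
  have h1 : (addIsthmuses M N.E).eRk (X ∩ (M.E ∪ N.E)) =
      (rk M X + (X ∩ (N.E \ M.E)).ncard : ℕ) := by
    rw [← addIsthmuses_ground, Matroid.eRk_inter_ground, addIsthmuses, disjointSum_eRk,
      ← Matroid.eRk_inter_ground (Matroid.freeOn _), Matroid.freeOn_ground,
      Matroid.eRk_freeOn inter_subset_right, Nat.cast_add, cast_rk,
      (N.ground_finite.sdiff.inter_of_right X).cast_ncard_eq]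
  have h2 : (addLoops N M.E).eRk (X ∩ (M.E ∪ N.E)) = rk N X := by
    rw [addLoops, disjointSum_eRk, Matroid.eRk_loopyOn, add_zero, ← cast_rk, Nat.cast_inj]
    exact rk_congr (by ext; simp; tauto)
  have h3 := higgsLift_eRk (rk M (M.E \ N.E)) _ _ h.isQuotient hX
  rw [h1, h2, ← addIsthmuses_ground,
    ← higgsLift_ground (rk M (M.E \ N.E)) (addIsthmuses M N.E) (addLoops N M.E) h.isQuotient,
    Matroid.eRk_inter_ground] at h3
  change (freeSplice M N h).eRk X = _ at h3
  rw [← cast_rk, ← Nat.cast_add (rk N X), ← (Nat.mono_cast (α := ℕ∞)).map_min] at h3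
  exact_mod_cast h3

end Rank

/-! ### The iterated splices as three-term minima, and what the matchings force -/

section Associativity

variable {α : Type*}

theorem rk_sdiff_le_rk_inter_sdiff_add_ncard (M N P : Matroid α) [N.Finite] :
    rk N (N.E \ P.E) ≤ rk N ((M.E ∩ N.E) \ P.E) + (N.E \ (M.E ∪ P.E)).ncard := by
  refine le_trans (rk_mono ?_) (rk_union_le_add_ncard _ N.ground_finite.sdiff)
  intro x; simp; tauto

theorem rk_ground_le_rk_inter_add_ncard (M N : Matroid α) [N.Finite] :
    rk N N.E ≤ rk N (M.E ∩ N.E) + (N.E \ M.E).ncard := by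
  refine le_trans (rk_mono ?_) (rk_union_le_add_ncard _ N.ground_finite.sdiff)
  intro x; simp; tauto

theorem sdiff_subset_coloops_iff (M N : Matroid α) [N.Finite] :
    N.E \ M.E ⊆ N.coloops ↔ rk N N.E = rk N (M.E ∩ N.E) + (N.E \ M.E).ncard := by
  rw [subset_coloops_iff_rk sdiff_subset, sdiff_sdiff_right_self, inter_comm]

variable {M N P : Matroid α} [M.Finite] [N.Finite] [P.Finite]

theorem rk_freeSplice_left {hMN : Matched M N} (h : Matched (freeSplice M N hMN) P) (X : Set α) :
    rk (freeSplice (freeSplice M N hMN) P h) X =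
      min (min (rk M X + (X ∩ (N.E \ M.E)).ncard) (rk N X + rk M (M.E \ N.E)) +
          (X ∩ (P.E \ (M.E ∪ N.E))).ncard)
        (rk P X + rk (freeSplice M N hMN) ((M.E ∪ N.E) \ P.E)) := by
  rw [rk_freeSplice h, freeSplice_ground, rk_freeSplice hMN X]

theorem rk_freeSplice_right {hNP : Matched N P} (h : Matched M (freeSplice N P hNP)) (X : Set α) :
    rk (freeSplice M (freeSplice N P hNP) h) X =
      min (rk M X + (X ∩ (N.E \ M.E)).ncard + (X ∩ (P.E \ (M.E ∪ N.E))).ncard)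
        (min (rk N X + (X ∩ ((M.E ∩ P.E) \ N.E)).ncard + (X ∩ (P.E \ (M.E ∪ N.E))).ncard)
          (rk P X + rk N (N.E \ P.E)) + rk M (M.E \ (N.E ∪ P.E))) := by
  have hN := N.ground_finite
  have hP := P.ground_finite
  have h1 : (X ∩ ((N.E ∪ P.E) \ M.E)).ncard =
      (X ∩ (N.E \ M.E)).ncard + (X ∩ (P.E \ (M.E ∪ N.E))).ncard := by
    rw [← ncard_union_eq _ (hN.sdiff.inter_of_right X) (hP.sdiff.inter_of_right X)]
    · congr 1; ext; simp; tauto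
    · rw [disjoint_left]; simp; tauto
  have h2 : (X ∩ (P.E \ N.E)).ncard =
      (X ∩ ((M.E ∩ P.E) \ N.E)).ncard + (X ∩ (P.E \ (M.E ∪ N.E))).ncard := by
    rw [← ncard_union_eq _ ((hP.inter_of_right M.E).sdiff.inter_of_right X)
      (hP.sdiff.inter_of_right X)]
    · congr 1; ext; simp; tauto
    · rw [disjoint_left]; simp; tauto
  rw [rk_freeSplice h, freeSplice_ground, rk_freeSplice hNP X, h1, h2, add_assoc, add_assoc]

theorem rk_union_of_matched_freeSplice {hNP : Matched N P} (h : Matched M (freeSplice N P hNP))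
    {Z : Set α} (hZ : Z ⊆ M.E ∩ (N.E ∪ P.E)) :
    rk M (Z ∪ M.E \ (N.E ∪ P.E)) = min (rk N Z + (Z ∩ (P.E \ N.E)).ncard)
      (rk P Z + rk N (N.E \ P.E)) + rk M (M.E \ (N.E ∪ P.E)) := by
  have := h.rk_union (Z := Z) (by rwa [freeSplice_ground])
  rwa [freeSplice_ground, rk_freeSplice] at this

/-- Contracting `M` to a set `Z` of common elements of `M` and `N`, and the elements that are
in `M` and `P` only. -/
theorem rk_add_rk_sdiff {hNP : Matched N P} (hMN : Matched M N)
    (h : Matched M (freeSplice N P hNP)) {Z : Set α} (hZ : Z ⊆ M.E ∩ N.E) :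
    rk N Z + rk M (M.E \ N.E) = min (rk N Z + ((M.E ∩ P.E) \ N.E).ncard)
      (rk P (Z ∪ (M.E ∩ P.E) \ N.E) + rk N (N.E \ P.E)) + rk M (M.E \ (N.E ∪ P.E)) := by
  have h1 := rk_union_of_matched_freeSplice h (Z := Z ∪ (M.E ∩ P.E) \ N.E)
    (by intro x hx; have := @hZ x; simp at *; tauto)
  have h2 := hMN.rk_union hZ
  rw [show Z ∪ (M.E ∩ P.E) \ N.E ∪ M.E \ (N.E ∪ P.E) = Z ∪ M.E \ N.E by
      ext; simp; tauto, h2,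
    show (Z ∪ (M.E ∩ P.E) \ N.E) ∩ (P.E \ N.E) = (M.E ∩ P.E) \ N.E by
      ext x; have := @hZ x; simp at *; tauto,
    show rk N (Z ∪ (M.E ∩ P.E) \ N.E) = rk N Z from rk_congr (by ext; simp; tauto)] at h1
  exact h1

/-- N ⋈ P restricts to `N` on B: the other term of its minimum is at least r_N(Z), since r_P(Z ∩ C)
+ β is the rank in `N` of a set containing Z. Hence matching `M` with N ⋈ P involves only `N` on
such Z. -/
theorem rk_union_of_subset_inter {hNP : Matched N P}
    (h : Matched M (freeSplice N P hNP)) {Z : Set α} (hZ : Z ⊆ M.E ∩ N.E) :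
    rk M (Z ∪ M.E \ (N.E ∪ P.E)) = rk N Z + rk M (M.E \ (N.E ∪ P.E)) := by
  have h1 := rk_union_of_matched_freeSplice h (Z := Z) (fun x hx ↦ ⟨(hZ hx).1, Or.inl (hZ hx).2⟩)
  have h2 := hNP.rk_union (Z := Z ∩ P.E) (fun x hx ↦ ⟨(hZ hx.1).2, hx.2⟩)
  have h3 : rk N Z ≤ rk N (Z ∩ P.E ∪ N.E \ P.E) :=
    rk_mono (by intro x hx; have := hZ hx; simp at *; tauto)
  have h4 : rk P (Z ∩ P.E) = rk P Z := rk_congr (by ext; simp)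
  rw [show Z ∩ (P.E \ N.E) = ∅ by ext x; have := @hZ x; simp at *; tauto, ncard_empty] at h1
  omega

/-- The rank in `M ⋈ N` of the set of elements not in `P`. -/
theorem rk_freeSplice_sdiff {hMN : Matched M N} {hNP : Matched N P}
    (h : Matched M (freeSplice N P hNP)) :
    rk (freeSplice M N hMN) ((M.E ∪ N.E) \ P.E) =
      min (rk N ((M.E ∩ N.E) \ P.E) + (N.E \ (M.E ∪ P.E)).ncard + rk M (M.E \ (N.E ∪ P.E)))
        (rk N (N.E \ P.E) + rk M (M.E \ N.E)) := by
  have h1 := rk_union_of_subset_inter h (Z := (M.E ∩ N.E) \ P.E) sdiff_subset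
  rw [rk_freeSplice,
    show rk M ((M.E ∪ N.E) \ P.E) = rk M ((M.E ∩ N.E) \ P.E ∪ M.E \ (N.E ∪ P.E)) from
      rk_congr (by ext; simp; tauto), h1,
    show rk N ((M.E ∪ N.E) \ P.E) = rk N (N.E \ P.E) from rk_congr (by ext; simp; tauto),
    show (M.E ∪ N.E) \ P.E ∩ (N.E \ M.E) = N.E \ (M.E ∪ P.E) by ext; simp; tauto]
  omega

/-- If the two iterated splices have the same rank, then the set of elements of `M ⋈ N` outside `P`
has the least rank in `M ⋈ N` that the matching conditions allow. -/
theorem rk_freeSplice_sdiff_eq_of_rk_ground_eq {hMN : Matched M N}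
    {hMN_P : Matched (freeSplice M N hMN) P} {hNP : Matched N P}
    {hM_NP : Matched M (freeSplice N P hNP)}
    (heq : rk (freeSplice (freeSplice M N hMN) P hMN_P) (M.E ∪ N.E ∪ P.E) =
      rk (freeSplice M (freeSplice N P hNP) hM_NP) (M.E ∪ N.E ∪ P.E)) :
    rk (freeSplice M N hMN) ((M.E ∪ N.E) \ P.E) =
      rk N (N.E \ P.E) + rk M (M.E \ (N.E ∪ P.E)) := by
  have hPfin := P.ground_finite
  have hG := rk_freeSplice_sdiff hM_NP (hMN := hMN)
  have hle := rk_sdiff_le_rk_inter_sdiff_add_ncard M N P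
  have hmono : rk M (M.E \ (N.E ∪ P.E)) ≤ rk M (M.E \ N.E) :=
    rk_mono (by intro x; simp; tauto)
  have h1 := hMN.rk_union (Z := M.E ∩ N.E) Subset.rfl
  rw [inter_union_sdiff] at h1
  have h2 := rk_ground_le_rk_inter_add_ncard M N
  have h3 := hNP.rk_union (Z := N.E ∩ P.E) Subset.rfl
  rw [inter_union_sdiff] at h3
  have h4 := hMN_P.rk_union (Z := (M.E ∪ N.E) ∩ P.E) (by rw [freeSplice_ground])
  rw [freeSplice_ground, inter_union_sdiff, rk_freeSplice] at h4
  have h5 : rk P P.E ≤ rk P ((M.E ∪ N.E) ∩ P.E) + (P.E \ (M.E ∪ N.E)).ncard := by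
    refine le_trans (rk_mono ?_) (rk_union_le_add_ncard _ hPfin.sdiff)
    intro x; simp; tauto
  have h6 : rk P ((M.E ∪ N.E) ∩ P.E) ≤
      rk P (N.E ∩ P.E) + ((M.E ∩ P.E) \ N.E).ncard := by
    refine le_trans (rk_mono ?_) (rk_union_le_add_ncard _ (hPfin.inter_of_right _).sdiff)
    intro x; simp; tauto
  rw [show rk N (M.E ∪ N.E) = rk N N.E from rk_congr (by ext; simp; tauto)] at h4
  -- On the full ground set the third term is the least on both sides: the left rank is r(P) + G and
  -- the right rank is r(P) + β + m'.
  rw [rk_freeSplice_left, rk_freeSplice_right,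
    show rk M (M.E ∪ N.E ∪ P.E) = rk M M.E from rk_congr (by ext; simp; tauto),
    show rk N (M.E ∪ N.E ∪ P.E) = rk N N.E from rk_congr (by ext; simp; tauto),
    show rk P (M.E ∪ N.E ∪ P.E) = rk P P.E from rk_congr (by ext; simp; tauto),
    show (M.E ∪ N.E ∪ P.E) ∩ (N.E \ M.E) = N.E \ M.E by ext; simp; tauto,
    show (M.E ∪ N.E ∪ P.E) ∩ (P.E \ (M.E ∪ N.E)) = P.E \ (M.E ∪ N.E) by ext; simp; tauto,
    show (M.E ∪ N.E ∪ P.E) ∩ ((M.E ∩ P.E) \ N.E) = (M.E ∩ P.E) \ N.E by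
      ext; simp; tauto] at heq
  omega

/-- Matching M ⋈ N with `P` on B ∩ C gives min(r_N(A ∩ B) + |B \ A| + m', r(N) + m) = r(N) + m'. As
m' < m, the first entry attains the minimum, so r(N) = r_N(A ∩ B) + |B \ A|. -/
theorem coloops_of_rk_freeSplice_sdiff_eq {hMN : Matched M N}
    (hMN_P : Matched (freeSplice M N hMN) P) {hNP : Matched N P}
    (hM_NP : Matched M (freeSplice N P hNP))
    (hG : rk (freeSplice M N hMN) ((M.E ∪ N.E) \ P.E) =
      rk N (N.E \ P.E) + rk M (M.E \ (N.E ∪ P.E)))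
    (hlt : rk M (M.E \ (N.E ∪ P.E)) < rk M (M.E \ N.E)) : N.E \ M.E ⊆ N.coloops := by
  rw [sdiff_subset_coloops_iff]
  have h1 := hMN_P.rk_union (Z := N.E ∩ P.E) (by rw [freeSplice_ground]; intro x; simp; tauto)
  have h2 := rk_union_of_subset_inter hM_NP (Z := M.E ∩ N.E) Subset.rfl
  have h3 := hNP.rk_union (Z := N.E ∩ P.E) Subset.rfl
  rw [inter_union_sdiff] at h3
  rw [freeSplice_ground, hG, rk_freeSplice,
    show rk M (N.E ∩ P.E ∪ (M.E ∪ N.E) \ P.E) = rk M (M.E ∩ N.E ∪ M.E \ (N.E ∪ P.E)) from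
      rk_congr (by ext; simp; tauto), h2,
    show rk N (N.E ∩ P.E ∪ (M.E ∪ N.E) \ P.E) = rk N N.E from rk_congr (by ext; simp; tauto),
    show (N.E ∩ P.E ∪ (M.E ∪ N.E) \ P.E) ∩ (N.E \ M.E) = N.E \ M.E by ext; simp; tauto] at h1
  omega

end Associativity

/-- If B \ C has rank zero, contracting it leaves the ranks in `N` unchanged, so `N` and `P` agree
on B ∩ C; the rest of C is D together with C \ (A ∪ B). This bound makes the second terms of both
minima redundant beside the third. -/
theorem rk_le_of_rk_sdiff_eq_zero {α : Type*} (M : Matroid α) {N P : Matroid α} [N.Finite]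
    [P.Finite] (hNP : Matched N P) (h : rk N (N.E \ P.E) = 0) (X : Set α) :
    rk P X ≤ rk N X + rk P (X ∩ ((M.E ∩ P.E) \ N.E)) +
      (X ∩ (P.E \ (M.E ∪ N.E))).ncard := by
  have h1 := hNP.rk_union (Z := X ∩ (N.E ∩ P.E)) inter_subset_right
  have h2 := rk_union_le_add_rk N X (N.E \ P.E)
  have h3 : rk N (X ∩ (N.E ∩ P.E) ∪ N.E \ P.E) ≤ rk N (X ∪ N.E \ P.E) :=
    rk_mono (union_subset_union_left _ inter_subset_left)
  have h4 := rk_union_le_add_rk P (X ∩ (N.E ∩ P.E)) (X ∩ ((M.E ∩ P.E) \ N.E))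
  have h5 := rk_union_le_add_ncard (M := P)
    (X ∩ (N.E ∩ P.E) ∪ X ∩ ((M.E ∩ P.E) \ N.E))
    ((P.ground_finite.sdiff (t := M.E ∪ N.E)).inter_of_right X)
  have h6 : rk P (X ∩ (N.E ∩ P.E) ∪ X ∩ ((M.E ∩ P.E) \ N.E) ∪
      X ∩ (P.E \ (M.E ∪ N.E))) = rk P X := rk_congr (by ext; simp; tauto)
  omega

/-! ### Sufficiency of the four conditions -/

section Sufficiency

variable {α : Type*} {M N P : Matroid α} [M.Finite] [N.Finite] [P.Finite] {hMN : Matched M N}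
  {hMN_P : Matched (freeSplice M N hMN) P} {hNP : Matched N P}
  {hM_NP : Matched M (freeSplice N P hNP)}

theorem freeSplice_assoc_of_rk
    (h : ∀ X, min (min (rk M X + (X ∩ (N.E \ M.E)).ncard) (rk N X + rk M (M.E \ N.E)) +
          (X ∩ (P.E \ (M.E ∪ N.E))).ncard)
        (rk P X + rk (freeSplice M N hMN) ((M.E ∪ N.E) \ P.E)) =
      min (rk M X + (X ∩ (N.E \ M.E)).ncard + (X ∩ (P.E \ (M.E ∪ N.E))).ncard)
        (min (rk N X + (X ∩ ((M.E ∩ P.E) \ N.E)).ncard + (X ∩ (P.E \ (M.E ∪ N.E))).ncard)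
          (rk P X + rk N (N.E \ P.E)) + rk M (M.E \ (N.E ∪ P.E)))) :
    freeSplice (freeSplice M N hMN) P hMN_P = freeSplice M (freeSplice N P hNP) hM_NP := by
  refine ext_rk (by simp only [freeSplice_ground, union_assoc]) fun X _ ↦ ?_
  rw [rk_freeSplice_left, rk_freeSplice_right, h]

/-- With D empty, m = m' and G = β + m', so the three terms agree one by one. -/
theorem freeSplice_assoc_of_eq_empty (hD : (M.E ∩ P.E) \ N.E = ∅) :
    freeSplice (freeSplice M N hMN) P hMN_P = freeSplice M (freeSplice N P hNP) hM_NP := by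
  have hG := rk_freeSplice_sdiff (hMN := hMN) hM_NP
  have hle := rk_sdiff_le_rk_inter_sdiff_add_ncard M N P
  have h0 := rk_add_rk_sdiff hMN hM_NP (empty_subset _)
  rw [empty_union, rk_empty, hD, ncard_empty] at h0
  refine freeSplice_assoc_of_rk fun X ↦ ?_
  rw [hD, inter_empty, ncard_empty]
  omega

theorem freeSplice_assoc_of_subset_coloops (hD : (M.E ∩ P.E) \ N.E ⊆ M.coloops)
    (hco : N.E \ M.E ⊆ N.coloops) :
    freeSplice (freeSplice M N hMN) P hMN_P = freeSplice M (freeSplice N P hNP) hM_NP := by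
  have hDfin : ((M.E ∩ P.E) \ N.E).Finite := (M.ground_finite.inter_of_left _).sdiff
  rw [subset_coloops_iff_rk (sdiff_subset.trans inter_subset_left)] at hD
  rw [subset_coloops_iff_rk sdiff_subset] at hco
  have hNr := rk_eq_of_rk_ground sdiff_subset hco
  have hδ : rk M (M.E \ N.E) = ((M.E ∩ P.E) \ N.E).ncard + rk M (M.E \ (N.E ∪ P.E)) := by
    have hM := hMN.rk_union (Z := M.E ∩ N.E) Subset.rfl
    have hMD := rk_union_of_subset_inter hM_NP (Z := M.E ∩ N.E) Subset.rfl
    rw [inter_union_sdiff] at hM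
    rw [show M.E ∩ N.E ∪ M.E \ (N.E ∪ P.E) = M.E \ ((M.E ∩ P.E) \ N.E) by
      ext; simp; tauto] at hMD
    omega
  have hG : rk (freeSplice M N hMN) ((M.E ∪ N.E) \ P.E) =
      rk N (N.E \ P.E) + rk M (M.E \ (N.E ∪ P.E)) := by
    have h1 := hNr (N.E \ P.E)
    rw [show (N.E \ P.E) \ (N.E \ M.E) = (M.E ∩ N.E) \ P.E by ext; simp; tauto,
      show (N.E \ P.E) ∩ (N.E \ M.E) = N.E \ (M.E ∪ P.E) by ext; simp; tauto] at h1
    rw [rk_freeSplice_sdiff hM_NP, hδ]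
    omega
  refine freeSplice_assoc_of_rk fun X ↦ ?_
  have hXD : (X ∩ ((M.E ∩ P.E) \ N.E)).ncard ≤ ((M.E ∩ P.E) \ N.E).ncard :=
    ncard_le_ncard inter_subset_right hDfin
  -- Both second terms are redundant beside the first: X ∩ A lies in (X ∩ A ∩ B) ∪ (A \ (B ∪ C)) ∪
  -- (X ∩ D), whose rank in `M` is at most r_N(X ∩ A ∩ B) + m' + |X ∩ D|. The left one follows
  -- because m = |D| + m'.
  have hX : rk M X + (X ∩ (N.E \ M.E)).ncard ≤
      rk N X + (X ∩ ((M.E ∩ P.E) \ N.E)).ncard + rk M (M.E \ (N.E ∪ P.E)) := by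
    have h2 := hNr X
    rw [show rk N (X \ (N.E \ M.E)) = rk N (X ∩ (M.E ∩ N.E)) from
      rk_congr (by ext; simp; tauto)] at h2
    have h3 := rk_union_of_subset_inter hM_NP (Z := X ∩ (M.E ∩ N.E)) inter_subset_right
    have h4 := rk_union_le_add_ncard (M := M) (X ∩ (M.E ∩ N.E) ∪ M.E \ (N.E ∪ P.E))
      (hDfin.inter_of_right X)
    have h5 : rk M (X ∩ M.E) ≤ rk M (X ∩ (M.E ∩ N.E) ∪ M.E \ (N.E ∪ P.E) ∪
        X ∩ ((M.E ∩ P.E) \ N.E)) := rk_mono (by intro x; simp; tauto)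
    rw [show rk M (X ∩ M.E) = rk M X from rk_congr (by ext; simp)] at h5
    omega
  rw [hG, hδ]
  omega

theorem freeSplice_assoc_of_subset_loops (hD : (M.E ∩ P.E) \ N.E ⊆ P.loops)
    (hβ : N.E \ P.E ⊆ N.loops) :
    freeSplice (freeSplice M N hMN) P hMN_P = freeSplice M (freeSplice N P hNP) hM_NP := by
  rw [subset_loops_iff_rk sdiff_subset] at hβ
  rw [subset_loops_iff_rk (sdiff_subset.trans inter_subset_right)] at hD
  have hG := rk_freeSplice_sdiff (hMN := hMN) hM_NP
  have h0 := rk_add_rk_sdiff hMN hM_NP (empty_subset _)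
  rw [empty_union, rk_empty] at h0
  refine freeSplice_assoc_of_rk fun X ↦ ?_
  have hXDP : rk P (X ∩ ((M.E ∩ P.E) \ N.E)) ≤ rk P ((M.E ∩ P.E) \ N.E) :=
    rk_mono inter_subset_right
  have h1 := rk_le_of_rk_sdiff_eq_zero M hNP hβ X
  -- Here r_P(D) + β = 0, so the minimum defining m - m' vanishes.
  have hδ : rk M (M.E \ N.E) = rk M (M.E \ (N.E ∪ P.E)) := by omega
  rw [hG, hδ]
  clear hG h0
  omega

/-- With β = 0 the formula for m - m' reads r_P(D), and b = 0 gives G = m'. The third terms are then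
both r_P(X) + m', and neither second term falls below this. -/
theorem freeSplice_assoc_of_subset_union (hb : N.E ⊆ M.E ∪ P.E) (hβ : N.E \ P.E ⊆ N.loops) :
    freeSplice (freeSplice M N hMN) P hMN_P = freeSplice M (freeSplice N P hNP) hM_NP := by
  have hDfin : ((M.E ∩ P.E) \ N.E).Finite := (M.ground_finite.inter_of_left _).sdiff
  rw [subset_loops_iff_rk sdiff_subset] at hβ
  have hδ : rk M (M.E \ N.E) = rk P ((M.E ∩ P.E) \ N.E) + rk M (M.E \ (N.E ∪ P.E)) := by
    have h0 := rk_add_rk_sdiff hMN hM_NP (empty_subset _)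
    rw [empty_union, rk_empty] at h0
    have h3 := rk_le_ncard (M := P) hDfin
    omega
  have hG : rk (freeSplice M N hMN) ((M.E ∪ N.E) \ P.E) = rk M (M.E \ (N.E ∪ P.E)) := by
    have h4 : rk N ((M.E ∩ N.E) \ P.E) ≤ rk N (N.E \ P.E) :=
      rk_mono (by intro x; simp; tauto)
    rw [rk_freeSplice_sdiff hM_NP, sdiff_eq_empty.2 hb, ncard_empty]
    omega
  refine freeSplice_assoc_of_rk fun X ↦ ?_
  have hXDP : rk P (X ∩ ((M.E ∩ P.E) \ N.E)) ≤ rk P ((M.E ∩ P.E) \ N.E) :=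
    rk_mono inter_subset_right
  have h1 := rk_le_of_rk_sdiff_eq_zero M hNP hβ X
  have h2 := rk_le_ncard (M := P) (hDfin.inter_of_right X)
  rw [hG, hδ, hβ]
  omega

end Sufficiency

/-- The free splice is associative exactly when one of four degeneracy conditions holds. -/
theorem freeSplice_assoc_iff {α : Type*} {M N P : Matroid α} [M.Finite] [N.Finite] [P.Finite]
    (hMN : Matched M N) (hMN_P : Matched (freeSplice M N hMN) P) (hNP : Matched N P)
    (hM_NP : Matched M (freeSplice N P hNP)) :
    freeSplice (freeSplice M N hMN) P hMN_P = freeSplice M (freeSplice N P hNP) hM_NP ↔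
      ((M.E ∩ P.E) \ N.E = ∅ ∨
        ((M.E ∩ P.E) \ N.E ⊆ M.coloops ∧ N.E \ M.E ⊆ N.coloops) ∨
        ((M.E ∩ P.E) \ N.E ⊆ P.loops ∧ N.E \ P.E ⊆ N.loops) ∨
        (N.E ⊆ M.E ∪ P.E ∧ (N.E \ M.E ⊆ N.coloops ∧ N.E \ P.E ⊆ N.loops) ∧
          IsModularPair P ((M.E ∩ P.E) \ N.E) (M.E ∩ N.E ∩ P.E))) := by
  have hNfin := N.ground_finite
  have hDfin : ((M.E ∩ P.E) \ N.E).Finite := (M.ground_finite.inter_of_left _).sdiff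
  have hDM : (M.E ∩ P.E) \ N.E ⊆ M.E := sdiff_subset.trans inter_subset_left
  have hDP : (M.E ∩ P.E) \ N.E ⊆ P.E := sdiff_subset.trans inter_subset_right
  have hG := rk_freeSplice_sdiff hM_NP (hMN := hMN)
  have h0 := rk_add_rk_sdiff hMN hM_NP (empty_subset _)
  rw [empty_union, rk_empty] at h0
  have hM := hMN.rk_union (Z := M.E ∩ N.E) Subset.rfl
  rw [inter_union_sdiff] at hM
  have hMD := rk_union_of_subset_inter hM_NP (Z := M.E ∩ N.E) Subset.rfl
  rw [show M.E ∩ N.E ∪ M.E \ (N.E ∪ P.E) = M.E \ ((M.E ∩ P.E) \ N.E) by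
    ext; simp; tauto] at hMD
  constructor
  · intro heq
    rw [subset_coloops_iff_rk hDM, subset_loops_iff_rk hDP, subset_loops_iff_rk sdiff_subset]
    -- Equality on the full ground set alone gives G = β + m'; the rest of necessity uses this and
    -- the matchings.
    have hGe := rk_freeSplice_sdiff_eq_of_rk_ground_eq (congrArg (rk · _) heq)
    by_cases hδ : rk M (M.E \ (N.E ∪ P.E)) < rk M (M.E \ N.E)
    swap
    · by_cases hD : (M.E ∩ P.E) \ N.E = ∅
      · exact Or.inl hD
      rw [← ncard_eq_zero hDfin] at hD
      -- Since m = m' and |D| > 0, the minimum of |D| and r_P(D) + β is zero only if r_P(D) = β = 0.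
      right; right; left
      omega
    have hco := coloops_of_rk_freeSplice_sdiff_eq hMN_P hM_NP hGe hδ
    by_cases hD : rk M (M.E \ N.E) = ((M.E ∩ P.E) \ N.E).ncard + rk M (M.E \ (N.E ∪ P.E))
    -- r_M(A) = r_N(A ∩ B) + m and r_M(A \ D) = r_N(A ∩ B) + m', so the two ranks differ by |D|.
    · exact Or.inr (Or.inl ⟨by omega, hco⟩)
    right; right; right
    -- Now m - m' = r_P(D) + β < |D|. Taking Z = (A ∩ B) \ C does not change r_P(Z ∪ D), which
    -- forces r_N(Z) = 0.
    have h1 := rk_add_rk_sdiff hMN hM_NP (Z := (M.E ∩ N.E) \ P.E) sdiff_subset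
    rw [show rk P ((M.E ∩ N.E) \ P.E ∪ (M.E ∩ P.E) \ N.E) = rk P ((M.E ∩ P.E) \ N.E) from
      rk_congr (by ext; simp; tauto)] at h1
    have h2 := hMN_P.rk_union (Z := (M.E ∩ P.E) \ N.E)
      (by rw [freeSplice_ground]; intro x; simp; tauto)
    have h3 := rk_union_of_matched_freeSplice hM_NP (Z := (M.E ∩ N.E) \ P.E ∪ (M.E ∩ P.E) \ N.E)
      (by intro x; simp; tauto)
    rw [freeSplice_ground, hGe, rk_freeSplice,
      show rk M ((M.E ∩ P.E) \ N.E ∪ (M.E ∪ N.E) \ P.E) =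
        rk M ((M.E ∩ N.E) \ P.E ∪ (M.E ∩ P.E) \ N.E ∪ M.E \ (N.E ∪ P.E)) from
        rk_congr (by ext; simp; tauto), h3,
      show rk N ((M.E ∩ N.E) \ P.E ∪ (M.E ∩ P.E) \ N.E) = rk N ((M.E ∩ N.E) \ P.E) from
        rk_congr (by ext; simp; tauto),
      show rk P ((M.E ∩ N.E) \ P.E ∪ (M.E ∩ P.E) \ N.E) = rk P ((M.E ∩ P.E) \ N.E) from
        rk_congr (by ext; simp; tauto),
      show rk N ((M.E ∩ P.E) \ N.E ∪ (M.E ∪ N.E) \ P.E) = rk N (N.E \ P.E) from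
        rk_congr (by ext; simp; tauto),
      show ((M.E ∩ P.E) \ N.E ∪ (M.E ∪ N.E) \ P.E) ∩ (N.E \ M.E) = N.E \ (M.E ∪ P.E) by
        ext; simp; tauto,
      show ((M.E ∩ N.E) \ P.E ∪ (M.E ∩ P.E) \ N.E) ∩ (P.E \ N.E) = (M.E ∩ P.E) \ N.E by
        ext; simp; tauto] at h2
    -- The two values of G give b = β, because m > m'; matching M ⋈ N with `P` on D (`h2`) gives
    -- min(b, β) = 0.
    have hb : (N.E \ (M.E ∪ P.E)).ncard = 0 := by omega
    have hβ : rk N (N.E \ P.E) = 0 := by omega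
    refine ⟨sdiff_eq_empty.1 ((ncard_eq_zero hNfin.sdiff).1 hb), ⟨hco, hβ⟩, hDP,
      inter_subset_right, ?_⟩
    -- With β = 0, `N` and `P` have the same rank on Z = A ∩ B ∩ C, and m - m' = r_P(D) < |D|; the
    -- relation for Z becomes r_P(Z) + r_P(D) = r_P(Z ∪ D).
    have h4 := rk_add_rk_sdiff hMN hM_NP (Z := M.E ∩ N.E ∩ P.E) inter_subset_left
    have h5 := hNP.rk_union (Z := M.E ∩ N.E ∩ P.E) (by intro x; simp; tauto)
    have h6 := rk_union_le_add_rk N (M.E ∩ N.E ∩ P.E) (N.E \ P.E)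
    have h7 : rk N (M.E ∩ N.E ∩ P.E) ≤ rk N (M.E ∩ N.E ∩ P.E ∪ N.E \ P.E) :=
      rk_mono subset_union_left
    rw [show ((M.E ∩ P.E) \ N.E) ∩ (M.E ∩ N.E ∩ P.E) = ∅ by ext; simp; tauto,
      Matroid.eRk_empty, add_zero, ← cast_rk, ← cast_rk, ← cast_rk, union_comm]
    norm_cast
    omega
  · rintro (hD | ⟨hD, hco⟩ | ⟨hD, hβ⟩ | ⟨hb, ⟨-, hβ⟩, -⟩)
    · exact freeSplice_assoc_of_eq_empty hD
    · exact freeSplice_assoc_of_subset_coloops hD hco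
    · exact freeSplice_assoc_of_subset_loops hD hβ
    · exact freeSplice_assoc_of_subset_union hb hβ

end FreeSplice

theorem theorem6p8 {α : Type*} (M N P : Matroid α) [M.Finite] [N.Finite] [P.Finite]
    (A B C : Set α) (hA : M.E = A) (hB : N.E = B) (hC : P.E = C)
    (hMN : FreeSplice.Matched M N)
    (hMN_P : FreeSplice.Matched (FreeSplice.freeSplice M N hMN) P)
    (hNP : FreeSplice.Matched N P)
    (hM_NP : FreeSplice.Matched M (FreeSplice.freeSplice N P hNP)) :
    FreeSplice.freeSplice (FreeSplice.freeSplice M N hMN) P hMN_P =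
        FreeSplice.freeSplice M (FreeSplice.freeSplice N P hNP) hM_NP ↔
      ((A ∩ C) \ B = ∅ ∨
        ((A ∩ C) \ B ⊆ M.coloops ∧ B \ A ⊆ N.coloops) ∨
        ((A ∩ C) \ B ⊆ P.loops ∧ B \ C ⊆ N.loops) ∨
        (B ⊆ A ∪ C ∧ (B \ A ⊆ N.coloops ∧ B \ C ⊆ N.loops) ∧
          FreeSplice.IsModularPair P ((A ∩ C) \ B) (A ∩ B ∩ C))) := by
  subst hA hB hC
  exact FreeSplice.freeSplice_assoc_iff hMN hMN_P hNP hM_NP
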